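/- Let $\mathcal L_{ring}=\{+,\cdot\,;0,1\}$ be the first-order language of rings, and regard $\mathbb{Q}$ as an $\mathcal L_{ring}$-structure in the usual way. Let $\phi(a,b,k)$ be the $\mathcal L_{ring}$-formula $$\phi(a,b,k):=\exists x\,\exists y\,\exists z\;\bigl(2+abk^2+bz^2=x^2+ay^2\bigr),$$ and let $\psi(n)$ be the $\mathcal L_{ring}$-formula $$\psi(n):=\forall a\,\forall b\,\Bigl(a\neq 0\wedge b\neq 0\;\to\;\bigl[\bigl\{\phi(a,b,0)\wedge\forall k\,\bigl(\phi(a,b,k)\to\phi(a,b,k+1)\bigr)\bigr\}\to\phi(a,b,n)\bigr]\Bigr),$$ where $2$ abbreviates $1+1$ and squares abbreviate products. (1) (Julia Robinson, 1949) For every $n\in\mathbb{Q}$, $$\mathbb{Q}\models\psi(n)\iff n\in\mathbb{Z}.$$ (2) The theory $\mathrm{Th}(\mathbb{Q})$, i.e. the set of all $\mathcal L_{ring}$-sentences true in $\mathbb{Q}$, is undecidable: there is no algorithm which, given as input an arbitrary $\mathcal L_{ring}$-sentence $\sigma$ (written as a string over a finite alphabet), answers YES if $\mathbb{Q}\models\sigma$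 and NO otherwise. -/

import Mathlib

namespace RingTheoryOfRat

open FirstOrder FirstOrder.Language

/-- The function symbols `+`, `·` (binary) and `0`, `1` (constants). -/
inductive RingFn : ℕ → Type
  | add : RingFn 2
  | mul : RingFn 2
  | zero : RingFn 0
  | one : RingFn 0

/-- The language of rings `{+, ·; 0, 1}`: no symbol for negation and no relation symbol
besides equality. -/
def Lring : FirstOrder.Language.{0, 0} where
  Functions := RingFn
  Relations := fun _ => Empty

/-- The terms `t + s`, `t · s`, `0`, `1`. -/
instance {α : Type} : Add (Lring.Term α) := ⟨fun t s => Term.func (L := Lring) RingFn.add ![t, s]⟩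

instance {α : Type} : Mul (Lring.Term α) := ⟨fun t s => Term.func (L := Lring) RingFn.mul ![t, s]⟩

instance {α : Type} : Zero (Lring.Term α) := ⟨Term.func (L := Lring) RingFn.zero ![]⟩

instance {α : Type} : One (Lring.Term α) := ⟨Term.func (L := Lring) RingFn.one ![]⟩

/-- The standard structure on `ℚ`: each symbol denotes the usual operation or constant. -/
instance : Lring.Structure ℚ where
  funMap := fun {_} f =>
    match f with
    | RingFn.add => fun x => x 0 + x 1
    | RingFn.mul => fun x => x 0 * x 1
    | RingFn.zero => fun _ => 0
    | RingFn.one => fun _ => 1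
  RelMap := fun {_} r => Empty.elim r

section Formulas

/-- The formula `φ(a,b,k) := ∃ x y z, 2 + a b k² + b z² = x² + a y²`, with free variables
`a, b, k` numbered `0, 1, 2` and with `2` written as `1 + 1`. -/
def phi : Lring.Formula (Fin 3) :=
  let a : Lring.Term (Fin 3 ⊕ Fin 3) := Term.var (Sum.inl 0)
  let b : Lring.Term (Fin 3 ⊕ Fin 3) := Term.var (Sum.inl 1)
  let k : Lring.Term (Fin 3 ⊕ Fin 3) := Term.var (Sum.inl 2)
  let x : Lring.Term (Fin 3 ⊕ Fin 3) := Term.var (Sum.inr 0)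
  let y : Lring.Term (Fin 3 ⊕ Fin 3) := Term.var (Sum.inr 1)
  let z : Lring.Term (Fin 3 ⊕ Fin 3) := Term.var (Sum.inr 2)
  ∃' ∃' ∃' (((1 + 1) + a * b * (k * k) + b * (z * z)) =' (x * x + a * (y * y)))

/-- The result of substituting the terms `a, b, k` for the free variables of `phi`, inside a
formula with one free variable and `m` quantified ones. -/
def phiAt {m : ℕ} (a b k : Lring.Term (Fin 1 ⊕ Fin m)) : Lring.BoundedFormula (Fin 1) m :=
  BoundedFormula.relabel (k := 0) id (phi.subst ![a, b, k])

/-- The formula `ψ(n) := ∀ a b ≠ 0, [{φ(a,b,0) ∧ ∀ k, (φ(a,b,k) → φ(a,b,k+1))} → φ(a,b,n)]`,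
with the only free variable `n`. -/
def psi : Lring.Formula (Fin 1) :=
  ∀' ∀' ((∼ ((&0 : Lring.Term (Fin 1 ⊕ Fin 2)) =' 0) ⊓ ∼ ((&1 : Lring.Term (Fin 1 ⊕ Fin 2)) =' 0)) ⟹
    ((phiAt (&0) (&1) 0 ⊓ ∀' (phiAt (&0) (&1) (&2) ⟹ phiAt (&0) (&1) (&2 + 1))) ⟹
      phiAt (&0) (&1) (Term.var (Sum.inl 0))))

theorem realize_add {α : Type} (t s : Lring.Term α) (v : α → ℚ) :
    (t + s).realize v = t.realize v + s.realize v := rfl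

theorem realize_mul {α : Type} (t s : Lring.Term α) (v : α → ℚ) :
    (t * s).realize v = t.realize v * s.realize v := rfl

theorem realize_zero {α : Type} (v : α → ℚ) : (0 : Lring.Term α).realize v = 0 := rfl

theorem realize_one {α : Type} (v : α → ℚ) : (1 : Lring.Term α).realize v = 1 := rfl

/-- The reading of `phi` in `ℚ`. -/
theorem realize_phi (v : Fin 3 → ℚ) :
    phi.Realize v ↔
      ∃ x y z : ℚ, 2 + v 0 * v 1 * v 2 ^ 2 + v 1 * z ^ 2 = x ^ 2 + v 0 * y ^ 2 := by
  simp only [phi, Formula.Realize, BoundedFormula.realize_ex, BoundedFormula.realize_bdEqual,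
    realize_add, realize_mul, realize_one, Term.realize_var, Sum.elim_inl, Sum.elim_inr,
    pow_two, one_add_one_eq_two]
  rfl

theorem realize_phiAt {m : ℕ} (a b k : Lring.Term (Fin 1 ⊕ Fin m)) (v : Fin 1 → ℚ)
    (xs : Fin m → ℚ) :
    (phiAt a b k).Realize v xs ↔
      phi.Realize ![a.realize (Sum.elim v xs), b.realize (Sum.elim v xs),
        k.realize (Sum.elim v xs)] := by
  rw [phiAt, BoundedFormula.realize_relabel, BoundedFormula.realize_subst, Formula.Realize]
  refine iff_of_eq (congrArg₂ _ (funext fun i => ?_) (Subsingleton.elim _ _))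
  fin_cases i <;> rfl

/-- The reading of `psi` in `ℚ`. -/
theorem realize_psi (n : ℚ) :
    psi.Realize (fun _ => n) ↔
      ∀ a b : ℚ, a ≠ 0 ∧ b ≠ 0 →
        (phi.Realize ![a, b, 0] ∧ ∀ k : ℚ, phi.Realize ![a, b, k] → phi.Realize ![a, b, k + 1]) →
        phi.Realize ![a, b, n] := by
  simp only [psi, Formula.Realize, BoundedFormula.realize_all, BoundedFormula.realize_imp,
    BoundedFormula.realize_inf, BoundedFormula.realize_not, BoundedFormula.realize_bdEqual,
    realize_phiAt, realize_add, realize_zero, realize_one, Term.realize_var, Sum.elim_inl]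
  rfl

end Formulas

section Coding

/-- The finite alphabet in which sentences are written. -/
inductive Symb : Type
  | add | mul | zero | one | eq | bot | imp | all | prime | var

/-- A numbering of the alphabet. -/
def Symb.equivFin : Symb ≃ Fin 10 where
  toFun
    | .add => 0 | .mul => 1 | .zero => 2 | .one => 3 | .eq => 4
    | .bot => 5 | .imp => 6 | .all => 7 | .prime => 8 | .var => 9
  invFun := ![.add, .mul, .zero, .one, .eq, .bot, .imp, .all, .prime, .var]
  left_inv := by rintro (_ | _) <;> rfl
  right_inv := by intro i; fin_cases i <;> rfl

instance : Primcodable Symb := Primcodable.ofEquiv (Fin 10) Symb.equivFin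

/-- The `i`-th variable, written as `i` primes followed by the letter `v`. -/
def varString (i : ℕ) : List Symb := List.replicate i Symb.prime ++ [Symb.var]

/-- The string of a term, in prefix (Polish) notation. -/
def termString {n : ℕ} : Lring.Term (Empty ⊕ Fin n) → List Symb
  | Term.var (Sum.inr i) => varString i
  | Term.func RingFn.add ts => Symb.add :: (termString (ts 0) ++ termString (ts 1))
  | Term.func RingFn.mul ts => Symb.mul :: (termString (ts 0) ++ termString (ts 1))
  | Term.func RingFn.zero _ => [Symb.zero]
  | Term.func RingFn.one _ => [Symb.one]

/-- The string of a formula without free variables other than the quantified ones numbered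
`0, …, n - 1`, in prefix notation; the next quantifier binds the variable numbered `n`. -/
def formulaString : {n : ℕ} → Lring.BoundedFormula Empty n → List Symb
  | _, BoundedFormula.falsum => [Symb.bot]
  | _, BoundedFormula.equal t s => Symb.eq :: (termString t ++ termString s)
  | _, BoundedFormula.rel R _ => Empty.elim R
  | _, BoundedFormula.imp f g => Symb.imp :: (formulaString f ++ formulaString g)
  | n, BoundedFormula.all f => Symb.all :: (varString n ++ formulaString f)

theorem varString_inj {i j : ℕ} {l l' : List Symb}
    (h : varString i ++ l = varString j ++ l') : i = j ∧ l = l' := by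
  induction i generalizing j with
  | zero => cases j <;> simp_all [varString, List.replicate_succ]
  | succ i ih =>
    cases j with
    | zero => simp [varString, List.replicate_succ] at h
    | succ j =>
      have := @ih j (by simpa [varString, List.replicate_succ] using h)
      simpa using this

theorem varString_cons (i : ℕ) :
    ∃ l, varString i = Symb.prime :: l ∨ varString i = Symb.var :: l := by
  cases i <;> simp [varString, List.replicate_succ]

theorem termString_inj {n : ℕ} (t s : Lring.Term (Empty ⊕ Fin n)) (l l' : List Symb)
    (h : termString t ++ l = termString s ++ l') : t = s ∧ l = l' := by
  induction t generalizing s l l' with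
  | var i =>
    rcases i with e | i
    · exact e.elim
    rcases s with (e | j) | ⟨g, us⟩
    · exact e.elim
    · obtain ⟨h1, h2⟩ := varString_inj (by simpa [termString] using h)
      exact ⟨by rw [Fin.ext h1], h2⟩
    · obtain ⟨r, hr⟩ := varString_cons i
      rcases hr with hr | hr <;> cases g <;> simp [termString, hr] at h
  | func f ts ih =>
    rcases s with (e | j) | ⟨g, us⟩
    · exact e.elim
    · obtain ⟨r, hr⟩ := varString_cons j
      rcases hr with hr | hr <;> cases f <;> simp [termString, hr] at h
    · cases f <;> cases g <;>
        simp only [termString, List.cons_append, List.append_assoc, List.cons.injEq,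
          reduceCtorEq, false_and, true_and, List.nil_append] at h
      · obtain ⟨h1, h2⟩ := ih 0 _ _ _ h
        obtain ⟨h3, h4⟩ := ih 1 _ _ _ h2
        exact ⟨congrArg _ (funext fun i => by fin_cases i <;> assumption), h4⟩
      · obtain ⟨h1, h2⟩ := ih 0 _ _ _ h
        obtain ⟨h3, h4⟩ := ih 1 _ _ _ h2
        exact ⟨congrArg _ (funext fun i => by fin_cases i <;> assumption), h4⟩
      · exact ⟨congrArg _ (Subsingleton.elim _ _), h⟩
      · exact ⟨congrArg _ (Subsingleton.elim _ _), h⟩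

/-- Strings determine formulas: no string is a proper initial segment of another one. -/
theorem formulaString_inj {n : ℕ} (f g : Lring.BoundedFormula Empty n) (l l' : List Symb)
    (h : formulaString f ++ l = formulaString g ++ l') : f = g ∧ l = l' := by
  induction f generalizing l l' with
  | falsum => cases g <;> simp_all [formulaString]; rename_i R _; exact R.elim
  | rel R => exact Empty.elim R
  | equal t s =>
    cases g with
    | equal t' s' =>
      simp only [formulaString, List.cons_append, List.append_assoc, List.cons.injEq,
        true_and] at h
      obtain ⟨h1, h2⟩ := termString_inj _ _ _ _ h
      obtain ⟨h3, h4⟩ := termString_inj _ _ _ _ h2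
      exact ⟨by rw [h1, h3], h4⟩
    | rel R => exact Empty.elim R
    | _ => simp [formulaString] at h
  | imp f₁ f₂ ih₁ ih₂ =>
    cases g with
    | imp g₁ g₂ =>
      simp only [formulaString, List.cons_append, List.append_assoc, List.cons.injEq,
        true_and] at h
      obtain ⟨h1, h2⟩ := ih₁ _ _ _ h
      obtain ⟨h3, h4⟩ := ih₂ _ _ _ h2
      exact ⟨by rw [h1, h3], h4⟩
    | rel R => exact Empty.elim R
    | _ => simp [formulaString] at h
  | all f ih =>
    cases g with
    | all g =>
      simp only [formulaString, List.cons_append, List.append_assoc, List.cons.injEq,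
        true_and] at h
      obtain ⟨h1, h2⟩ := ih _ _ _ (varString_inj h).2
      exact ⟨by rw [h1], h2⟩
    | rel R => exact Empty.elim R
    | _ => simp [formulaString] at h

/-- Different sentences have different strings. -/
theorem formulaString_injective :
    Function.Injective (formulaString : Lring.Sentence → List Symb) :=
  fun f g h => (formulaString_inj f g [] [] (by rw [h])).1

end Coding

/-- A set `T` of sentences is decidable if there is an algorithm (a recursive function) which, given
the string of any sentence `σ`, answers whether `σ` belongs to `T`. -/
def TheoryDecidable (T : Lring.Theory) : Prop :=
  ∃ f : List Symb → Bool, Computable f ∧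
    ∀ σ : Lring.Sentence, f (formulaString σ) = true ↔ σ ∈ T

end RingTheoryOfRat

/-!
Robinson's argument rests on the ramification of quaternion algebras. For `(a, b) = (1, 3)`, and for
`(a, b) = (q, p)` with `p` an odd prime and `q` a suitable prime congruent to `3` modulo `4`, the
formula `φ(a, b, k)` says precisely that the denominator of `k` is prime to two fixed primes, those
at which the quaternion algebra with parameters `-a` and `b` ramifies. If such a prime divides the
denominator of `k`, infinite descent on a common denominator rules out a solution. Otherwise one
clears denominators to `M w² + b z² = x² + a y²`; quadratic reciprocity and Dirichlet's theorem
provide a prime `l` satisfying the local conditions of Legendre's theorem for both `l = M w² + b z²`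
and `l = x² + a y²`. A condition on the denominator of `k` is invariant under `k ↦ k + 1`, so `ψ(n)`
forces every prime away from the denominator of `n`, while every integer satisfies `ψ` by induction.

Together with Lagrange's four-square theorem this defines `ℕ` in `ℚ`. Gödel's `β` function then
makes every recursively enumerable set of natural numbers definable in `ℚ`, in particular the set
of programs that halt, so deciding `Th(ℚ)` would decide the halting problem.
-/

namespace RingTheoryOfRat

/-! ### Legendre's theorem on ternary quadratic forms -/

theorem mul_mul_dvd_ternary_form {R : Type*} [CommRing R] {a b c r s t x y z : R}
    (hab : IsCoprime a b) (hbc : IsCoprime b c) (hac : IsCoprime a c)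
    (hr : a ∣ b * r ^ 2 - c) (hs : b ∣ c * s ^ 2 - a) (ht : c ∣ a * t ^ 2 + b)
    (ha : a ∣ y - r * z) (hb : b ∣ z - s * x) (hc : c ∣ x - t * y) :
    a * b * c ∣ a * x ^ 2 + b * y ^ 2 - c * z ^ 2 := by
  have ha' : a ∣ a * x ^ 2 + b * y ^ 2 - c * z ^ 2 := by
    rw [show a * x ^ 2 + b * y ^ 2 - c * z ^ 2 =
      b * (y + r * z) * (y - r * z) + (b * r ^ 2 - c) * z ^ 2 + a * x ^ 2 by ring]
    exact ((ha.mul_left _).add (hr.mul_right _)).add (dvd_mul_right _ _)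
  have hb' : b ∣ a * x ^ 2 + b * y ^ 2 - c * z ^ 2 := by
    rw [show a * x ^ 2 + b * y ^ 2 - c * z ^ 2 =
      b * y ^ 2 - c * (z + s * x) * (z - s * x) - (c * s ^ 2 - a) * x ^ 2 by ring]
    exact ((dvd_mul_right _ _).sub (hb.mul_left _)).sub (hs.mul_right _)
  have hc' : c ∣ a * x ^ 2 + b * y ^ 2 - c * z ^ 2 := by
    rw [show a * x ^ 2 + b * y ^ 2 - c * z ^ 2 =
      a * (x + t * y) * (x - t * y) + (a * t ^ 2 + b) * y ^ 2 - c * z ^ 2 by ring]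
    exact ((hc.mul_left _).add (ht.mul_right _)).sub (dvd_mul_right _ _)
  exact (hac.mul_left hbc).mul_dvd (hab.mul_dvd ha' hb') hc'

theorem exists_ternary_zero_of_mul_mul_dvd {a b c x y z : ℤ} (ha : 0 < a) (hb : 0 < b) (hc : 0 < c)
    (hx : x ^ 2 < b * c) (hy : y ^ 2 ≤ a * c) (hz : z ^ 2 < a * b)
    (hxyz : ¬ (x = 0 ∧ y = 0 ∧ z = 0)) (h : a * b * c ∣ a * x ^ 2 + b * y ^ 2 - c * z ^ 2) :
    ∃ x y z : ℤ, z ≠ 0 ∧ a * x ^ 2 + b * y ^ 2 = c * z ^ 2 := by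
  obtain ⟨k, hk⟩ := h
  have habc : 0 < a * b * c := by positivity
  have hk_lt : k < 2 := by
    refine lt_of_mul_lt_mul_left (a := a * b * c) ?_ habc.le
    linarith [mul_lt_mul_of_pos_left hx ha, mul_le_mul_of_nonneg_left hy hb.le,
      mul_nonneg hc.le (sq_nonneg z)]
  have lt_hk : -1 < k := by
    refine lt_of_mul_lt_mul_left (a := a * b * c) ?_ habc.le
    linarith [mul_lt_mul_of_pos_left hz hc, mul_nonneg ha.le (sq_nonneg x),
      mul_nonneg hb.le (sq_nonneg y)]
  obtain rfl | rfl : k = 0 ∨ k = 1 := by omega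
  · refine ⟨x, y, z, ?_, by linarith⟩
    rintro rfl
    have hx0 : x ^ 2 = 0 := by nlinarith [sq_nonneg x, sq_nonneg y]
    have hy0 : y ^ 2 = 0 := by nlinarith [sq_nonneg x, sq_nonneg y]
    exact hxyz ⟨pow_eq_zero_iff two_ne_zero |>.1 hx0, pow_eq_zero_iff two_ne_zero |>.1 hy0, rfl⟩
  · -- Mordell's identity:
    -- `(z² + ab)(ax² + by² - cz² - abc) = a(xz + by)² + b(yz - ax)² - c(z² + ab)²`.
    refine ⟨x * z + b * y, y * z - a * x, z ^ 2 + a * b, by positivity, ?_⟩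
    linear_combination (z ^ 2 + a * b) * hk

theorem exists_ne_zero_map_eq_zero_of_card_lt {ι G : Type*} [Fintype ι] [AddGroup G] [Fintype G]
    (B : ι → ℕ) (F : (ι → ℤ) →+ G) (h : Fintype.card G < ∏ i, (B i + 1)) :
    ∃ v : ι → ℤ, v ≠ 0 ∧ (∀ i, |v i| ≤ B i) ∧ F v = 0 := by
  classical
  have hcard : (Finset.univ : Finset G).card <
      (Fintype.piFinset fun i => Finset.Icc (0 : ℤ) (B i)).card := by
    simpa [Fintype.card_piFinset, Int.card_Icc] using h
  obtain ⟨v, hv, w, hw, hne, hvw⟩ := Finset.exists_ne_map_eq_of_card_lt_of_maps_to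
    (f := F) hcard fun _ _ => Finset.mem_coe.2 (Finset.mem_univ _)
  simp only [Fintype.mem_piFinset, Finset.mem_Icc] at hv hw
  refine ⟨v - w, sub_ne_zero.2 hne, fun i => ?_, by rw [map_sub, hvw, sub_self]⟩
  have := hv i
  have := hw i
  rw [Pi.sub_apply, abs_le]
  omega

theorem sq_lt_of_abs_le_sqrt {m : ℕ} (hm : ¬ IsSquare m) {x : ℤ} (hx : |x| ≤ m.sqrt) :
    x ^ 2 < m := by
  refine lt_of_le_of_ne
    ((Int.abs_le_sqrt_iff_sq_le (Int.natCast_nonneg m)).1 (by simpa using hx)) fun h => ?_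
  exact hm ⟨x.natAbs, by zify; rw [← h, pow_two, abs_mul_abs_self]⟩

theorem mul_mul_lt_sqrt_add_one_mul (a b c : ℕ) :
    a * (b * c) < (Nat.sqrt (b * c) + 1) * (Nat.sqrt (a * c) + 1) * (Nat.sqrt (a * b) + 1) := by
  have hbc := Nat.lt_succ_sqrt' (b * c)
  have hac := Nat.lt_succ_sqrt' (a * c)
  have hab := Nat.lt_succ_sqrt' (a * b)
  refine lt_of_pow_lt_pow_left₀ 2 (Nat.zero_le _) ?_
  calc (a * (b * c)) ^ 2 = (b * c) * (a * c) * (a * b) := by ring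
    _ < ((b * c).sqrt + 1) ^ 2 * ((a * c).sqrt + 1) ^ 2 * ((a * b).sqrt + 1) ^ 2 := by gcongr
    _ = _ := by ring

theorem exists_ternary_zero_of_not_isSquare {a b c : ℕ} (hab : a.Coprime b) (hbc : b.Coprime c)
    (hac : a.Coprime c) (hab' : ¬ IsSquare (a * b)) (hbc' : ¬ IsSquare (b * c)) {r s t : ℤ}
    (hr : (a : ℤ) ∣ b * r ^ 2 - c) (hs : (b : ℤ) ∣ c * s ^ 2 - a) (ht : (c : ℤ) ∣ a * t ^ 2 + b) :
    ∃ x y z : ℤ, z ≠ 0 ∧ a * x ^ 2 + b * y ^ 2 = c * z ^ 2 := by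
  have ha : a ≠ 0 := by rintro rfl; simp at hab'
  have hb : b ≠ 0 := by rintro rfl; simp at hab'
  have hc : c ≠ 0 := by rintro rfl; simp at hbc'
  have : NeZero a := ⟨ha⟩
  have : NeZero b := ⟨hb⟩
  have : NeZero c := ⟨hc⟩
  let F : (Fin 3 → ℤ) →+ ZMod a × ZMod b × ZMod c :=
    AddMonoidHom.mk' (fun v => ((v 1 - r * v 2 : ℤ), (v 2 - s * v 0 : ℤ), (v 0 - t * v 1 : ℤ)))
      fun v w => by ext <;> push_cast [Pi.add_apply, Prod.fst_add, Prod.snd_add] <;> ring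
  obtain ⟨v, hv0, hv, hFv⟩ := exists_ne_zero_map_eq_zero_of_card_lt
    ![Nat.sqrt (b * c), Nat.sqrt (a * c), Nat.sqrt (a * b)] F
    (by simpa [Fin.prod_univ_three, ZMod.card] using mul_mul_lt_sqrt_add_one_mul a b c)
  simp only [F, AddMonoidHom.mk'_apply, Prod.mk_eq_zero, ZMod.intCast_zmod_eq_zero_iff_dvd] at hFv
  obtain ⟨hFa, hFb, hFc⟩ := hFv
  have hx : v 0 ^ 2 < (b * c : ℤ) := mod_cast sq_lt_of_abs_le_sqrt hbc' (hv 0)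
  have hy : v 1 ^ 2 ≤ (a * c : ℤ) :=
    mod_cast (Int.abs_le_sqrt_iff_sq_le (Int.natCast_nonneg (a * c))).1
      (by rw [Int.sqrt_natCast]; exact hv 1)
  have hz : v 2 ^ 2 < (a * b : ℤ) := mod_cast sq_lt_of_abs_le_sqrt hab' (hv 2)
  refine exists_ternary_zero_of_mul_mul_dvd (by positivity) (by positivity) (by positivity)
    hx hy hz (fun h => hv0 ?_) (mul_mul_dvd_ternary_form hab.isCoprime hbc.isCoprime hac.isCoprime
      hr hs ht hFa hFb hFc)
  ext i
  fin_cases i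
  exacts [h.1, h.2.1, h.2.2]

theorem exists_sq_of_isSquare_mul_of_coprime {a b : ℕ} (hab : a.Coprime b)
    (h : IsSquare (a * b)) : ∃ d, a = d ^ 2 := by
  obtain ⟨w, hw⟩ := h
  exact exists_eq_pow_of_mul_eq_pow (Nat.isUnit_iff.2 hab) (hw.trans (pow_two w).symm)

theorem exists_ternary_zero_of_isSquare {a b c : ℕ} (ha : a ≠ 0) (hb : b ≠ 0)
    (hab : a.Coprime b) (hbc : b.Coprime c) (hsq : IsSquare (a * b)) {t : ℤ}
    (ht : (c : ℤ) ∣ a * t ^ 2 + b) :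
    ∃ x y z : ℤ, z ≠ 0 ∧ a * x ^ 2 + b * y ^ 2 = c * z ^ 2 := by
  obtain ⟨d, rfl⟩ := exists_sq_of_isSquare_mul_of_coprime hab hsq
  obtain ⟨e, rfl⟩ := exists_sq_of_isSquare_mul_of_coprime hab.symm (by rwa [mul_comm])
  obtain ⟨u, v, rfl⟩ : ∃ u v, c = u ^ 2 + v ^ 2 := by
    refine Nat.eq_sq_add_sq_of_isSquare_mod_neg_one ⟨d * t * (e : ZMod c)⁻¹, ?_⟩
    have he : (e : ZMod c) * (e : ZMod c)⁻¹ = 1 :=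
      ZMod.coe_mul_inv_eq_one e (Nat.Coprime.coprime_dvd_left (dvd_pow_self e two_ne_zero) hbc)
    have ht' : ((d : ZMod c) * t) ^ 2 + (e : ZMod c) ^ 2 = 0 := by
      have := (ZMod.intCast_zmod_eq_zero_iff_dvd _ c).2 ht
      push_cast at this
      linear_combination this
    linear_combination (-(e : ZMod c)⁻¹ ^ 2) * ht' + (1 + e * (e : ZMod c)⁻¹) * he
  refine ⟨e * u, d * v, d * e, ?_, by push_cast; ring⟩
  simp_all

theorem legendre_exists_ternary_zero {a b c : ℕ} (ha : a ≠ 0) (hb : b ≠ 0)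
    (hab : a.Coprime b) (hbc : b.Coprime c) (hac : a.Coprime c) {r s t : ℤ}
    (hr : (a : ℤ) ∣ b * r ^ 2 - c) (hs : (b : ℤ) ∣ c * s ^ 2 - a) (ht : (c : ℤ) ∣ a * t ^ 2 + b) :
    ∃ x y z : ℤ, z ≠ 0 ∧ a * x ^ 2 + b * y ^ 2 = c * z ^ 2 := by
  by_cases hab' : IsSquare (a * b)
  · exact exists_ternary_zero_of_isSquare ha hb hab hbc hab' ht
  by_cases hbc' : IsSquare (b * c)
  · obtain ⟨w, hw⟩ := hbc'
    refine ⟨0, w, b, by exact_mod_cast hb, ?_⟩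
    zify at hw
    linear_combination -(b : ℤ) * hw
  exact exists_ternary_zero_of_not_isSquare hab hbc hac hab' hbc' hr hs ht

/-! ### Primes represented by binary quadratic forms -/

open scoped NumberTheorySymbols

theorem jacobiSym_natCast_eq_of_modEq {a b n : ℕ} (h : a ≡ b [MOD n]) : J(a | n) = J(b | n) :=
  jacobiSym.mod_left' (Int.natCast_modEq_iff.2 h)

theorem jacobiSym_sq_of_coprime {a b : ℕ} (h : a.Coprime b) : J(a | b) ^ 2 = 1 :=
  jacobiSym.sq_one h

theorem exists_prime_gt_and_forall_modEq {ι : Type*} (a s : ι → ℕ) (L : List ι)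
    (hs : L.Pairwise (Function.onFun Nat.Coprime s)) (hs0 : ∀ i ∈ L, s i ≠ 0)
    (has : ∀ i ∈ L, (a i).Coprime (s i)) (n : ℕ) :
    ∃ p > n, p.Prime ∧ ∀ i ∈ L, p ≡ a i [MOD s i] := by
  obtain ⟨r, hr⟩ := Nat.chineseRemainderOfList a s L hs
  have hprod : (L.map s).prod ≠ 0 := by simpa [List.prod_eq_zero_iff] using hs0
  have hcop : r.Coprime (L.map s).prod := by
    refine Nat.coprime_list_prod_right_iff.2 fun m hm => ?_
    obtain ⟨i, hi, rfl⟩ := List.mem_map.1 hm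
    exact (hr i hi).gcd_eq.trans (has i hi)
  obtain ⟨p, hpn, hp, hpr⟩ := Nat.forall_exists_prime_gt_and_modEq n hprod hcop
  exact ⟨p, hpn, hp, fun i hi =>
    (hpr.of_dvd (List.dvd_prod (List.mem_map_of_mem hi))).trans (hr i hi)⟩

theorem jacobiSym_neg_mul_of_mod_four_eq_one {l n M : ℕ} (hl : l % 4 = 1) (hn : Odd n)
    (hln : l ≡ M [MOD n]) : J(-(M * n) | l) = J(M | l) * J(M | n) := by
  have hl_odd : Odd l := Nat.odd_iff.2 (by omega)
  rw [jacobiSym.neg _ hl_odd, ZMod.χ₄_nat_one_mod_four hl, one_mul, jacobiSym.mul_left,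
    jacobiSym.quadratic_reciprocity_one_mod_four' hn hl, jacobiSym_natCast_eq_of_modEq hln]

theorem jacobiSym_neg_mul_of_mod_four_eq_three {l n M : ℕ} (hl : l % 4 = 3) (hn : n % 4 = 3)
    (hM : M % 4 = 3) (hMn : M.Coprime n) (hlM : l ≡ n [MOD M]) (hln : l ≡ M [MOD n]) :
    J(-(M * n) | l) = 1 := by
  have hl_odd : Odd l := Nat.odd_iff.2 (by omega)
  rw [jacobiSym.neg _ hl_odd, ZMod.χ₄_nat_three_mod_four hl, jacobiSym.mul_left,
    jacobiSym.quadratic_reciprocity_three_mod_four hM hl,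
    jacobiSym.quadratic_reciprocity_three_mod_four hn hl, jacobiSym_natCast_eq_of_modEq hlM,
    jacobiSym_natCast_eq_of_modEq hln, jacobiSym.quadratic_reciprocity_three_mod_four hn hM]
  linear_combination jacobiSym_sq_of_coprime hMn

theorem exists_residue_of_odd {M n : ℕ} (hM : Odd M) (hn : Odd n) (hMn : M.Coprime n) :
    ∃ c, (c % 4 = 1 ∨ c % 4 = 3 ∧ M % 4 = 3) ∧ ∀ l, l ≡ c [MOD 8] → l ≡ n [MOD M] →
      l ≡ M [MOD n] → J(-(M * n) | l) = 1 := by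
  by_cases h : M % 4 = 3 ∧ n % 4 = 3
  · refine ⟨3, Or.inr ⟨rfl, h.1⟩, fun l hl hlM hln => ?_⟩
    have hl4 : l % 4 = 3 := hl.of_dvd (by decide : 4 ∣ 8)
    exact jacobiSym_neg_mul_of_mod_four_eq_three hl4 h.2 h.1 hMn hlM hln
  · refine ⟨1, Or.inl rfl, fun l hl hlM hln => ?_⟩
    have hl4 : l % 4 = 1 := hl.of_dvd (by decide : 4 ∣ 8)
    have hrec : J(n | M) = J(M | n) := by
      rcases Nat.odd_mod_four_iff.1 (Nat.odd_iff.1 hM) with hM4 | hM4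
      · exact jacobiSym.quadratic_reciprocity_one_mod_four' hn hM4
      · have hn4 : n % 4 = 1 :=
          (Nat.odd_mod_four_iff.1 (Nat.odd_iff.1 hn)).resolve_right fun hn4 => h ⟨hM4, hn4⟩
        exact jacobiSym.quadratic_reciprocity_one_mod_four hn4 hM
    rw [jacobiSym_neg_mul_of_mod_four_eq_one hl4 hn hln,
      jacobiSym.quadratic_reciprocity_one_mod_four' hM hl4, jacobiSym_natCast_eq_of_modEq hlM, hrec,
      ← pow_two, jacobiSym_sq_of_coprime hMn]

theorem exists_residue_of_eq_two_mul {m n : ℕ} (hm : Odd m) (hn : Odd n)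
    (hmn : (2 * m).Coprime n) :
    ∃ c, c % 4 = 1 ∧ ∀ l, l ≡ c [MOD 8] → l ≡ n [MOD 2 * m] →
      l ≡ 2 * m [MOD n] → J(-((2 * m : ℕ) * n) | l) = 1 := by
  have hnm : n.Coprime m := hmn.coprime_mul_left.symm
  obtain ⟨c, hc, hχ⟩ : ∃ c : ℕ, c % 4 = 1 ∧ ZMod.χ₈ c = J(n | m) * J((2 * m : ℕ) | n) := by
    rcases jacobiSym.eq_one_or_neg_one (a := n) (b := m) hnm with h₁ | h₁ <;>
    rcases jacobiSym.eq_one_or_neg_one (a := (2 * m : ℕ)) (b := n) hmn with h₂ | h₂ <;>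
    rw [h₁, h₂]
    exacts [⟨1, rfl, rfl⟩, ⟨5, rfl, rfl⟩, ⟨5, rfl, rfl⟩, ⟨1, rfl, rfl⟩]
  refine ⟨c, hc, fun l hl hlm hln => ?_⟩
  have hl4 : l % 4 = 1 := Eq.trans (hl.of_dvd (by decide : 4 ∣ 8)) hc
  have hl8 : ZMod.χ₈ l = ZMod.χ₈ c := congrArg _ ((ZMod.natCast_eq_natCast_iff _ _ _).2 hl)
  have hJ : J((2 * m : ℕ) | l) = J((2 * m : ℕ) | n) * J(n | m) ^ 2 := by
    rw [Nat.cast_mul, jacobiSym.mul_left, Nat.cast_two,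
      jacobiSym.at_two (Nat.odd_iff.2 (by omega)), hl8, hχ,
      jacobiSym.quadratic_reciprocity_one_mod_four' hm hl4,
      jacobiSym_natCast_eq_of_modEq (hlm.of_dvd (dvd_mul_left m 2))]
    push_cast
    ring
  rw [jacobiSym_neg_mul_of_mod_four_eq_one hl4 hn hln, hJ, jacobiSym_sq_of_coprime hnm,
    mul_one, ← pow_two, jacobiSym_sq_of_coprime hmn]

theorem exists_odd_eq_or_eq_two_mul {M : ℕ} (hM : ¬ 4 ∣ M) : ∃ m, Odd m ∧ (M = m ∨ M = 2 * m) := by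
  rcases Nat.even_or_odd' M with ⟨m, rfl | rfl⟩
  · exact ⟨m, Nat.odd_iff.2 (by omega), Or.inr rfl⟩
  · exact ⟨2 * m + 1, odd_two_mul_add_one m, Or.inl rfl⟩

theorem exists_prime_jacobiSym_neg_mul_eq_one {M n N : ℕ} (hM : ¬ 4 ∣ M) (hn : Odd n) (hN : Odd N)
    (hMn : M.Coprime n) (hMN : M.Coprime N) (hnN : n.Coprime N) :
    ∃ l > M + n, l.Prime ∧ l ≡ n [MOD M] ∧ l ≡ M [MOD n] ∧ l ≡ 1 [MOD N] ∧
      (l % 4 = 1 ∨ l % 4 = 3 ∧ M % 4 = 3) ∧ J(-(M * n) | l) = 1 := by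
  obtain ⟨m, hm, hMm⟩ := exists_odd_eq_or_eq_two_mul hM
  obtain ⟨c, hc, hJ⟩ : ∃ c, (c % 4 = 1 ∨ c % 4 = 3 ∧ M % 4 = 3) ∧ ∀ l, l ≡ c [MOD 8] →
      l ≡ n [MOD M] → l ≡ M [MOD n] → J(-(M * n) | l) = 1 := by
    rcases hMm with rfl | rfl
    · exact exists_residue_of_odd hm hn hMn
    · obtain ⟨c, hc, hJ⟩ := exists_residue_of_eq_two_mul hm hn hMn
      exact ⟨c, Or.inl hc, hJ⟩
  have hmM : m ∣ M := by rcases hMm with rfl | rfl <;> simp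
  have hmn : m.Coprime n := hMn.coprime_dvd_left hmM
  have hmN : m.Coprime N := hMN.coprime_dvd_left hmM
  have h8 {k : ℕ} (hk : Odd k) : Nat.Coprime 8 k := hk.coprime_two_left.pow_left 3
  have hc8 : c.Coprime 8 := (h8 (Nat.odd_iff.2 (by omega))).symm
  obtain ⟨l, hlgt, hl, hmod⟩ := exists_prime_gt_and_forall_modEq Prod.fst Prod.snd
    [(c, 8), (n, m), (M, n), (1, N)]
    (by simpa [Function.onFun] using ⟨⟨h8 hm, h8 hn, h8 hN⟩, ⟨hmn, hmN⟩, hnN⟩)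
    (by simp [hm.pos.ne', hn.pos.ne', hN.pos.ne'])
    (by simpa using ⟨hc8, hmn.symm, hMn⟩) (M + n)
  simp only [List.forall_mem_cons, List.not_mem_nil] at hmod
  obtain ⟨hl8, hlm, hln, hlN, -⟩ := hmod
  have hlM : l ≡ n [MOD M] := by
    rcases hMm with rfl | rfl
    · exact hlm
    · have hl2 : l ≡ n [MOD 2] := by
        have := hl8.of_dvd (by decide : 2 ∣ 8)
        have := Nat.odd_iff.1 hn
        simp only [Nat.ModEq] at *
        omega
      exact (Nat.modEq_and_modEq_iff_modEq_mul hm.coprime_two_left).1 ⟨hl2, hlm⟩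
  have hlc : l % 4 = c % 4 := hl8.of_dvd (by decide : 4 ∣ 8)
  exact ⟨l, hlgt, hl, hlM, hln, hlN, hlc ▸ hc, hJ l hl8 hlM hln⟩

theorem exists_dvd_mul_sq_add {l M n : ℕ} (hl : l.Prime) (hM : M.Coprime l)
    (hJ : J(-(M * n) | l) = 1) : ∃ t : ℤ, (l : ℤ) ∣ M * t ^ 2 + n := by
  have := Fact.mk hl
  obtain ⟨u, hu⟩ := ZMod.isSquare_of_jacobiSym_eq_one hJ
  have hM' := ZMod.coe_mul_inv_eq_one M hM
  obtain ⟨t, ht⟩ := ZMod.intCast_surjective (u * (M : ZMod l)⁻¹)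
  refine ⟨t, (ZMod.intCast_zmod_eq_zero_iff_dvd _ l).1 ?_⟩
  push_cast at hu ⊢
  rw [ht]
  linear_combination -((M : ZMod l) * (M : ZMod l)⁻¹ ^ 2) * hu -
    (n * (M * (M : ZMod l)⁻¹ + 1)) * hM'

theorem exists_prime_eq_mul_sq_add_mul_sq {M n N : ℕ} (hM : ¬ 4 ∣ M) (hn : Odd n) (hN : Odd N)
    (hMn : M.Coprime n) (hMN : M.Coprime N) (hnN : n.Coprime N) :
    ∃ l : ℕ, l.Prime ∧ l ≡ 1 [MOD N] ∧ (l % 4 = 1 ∨ l % 4 = 3 ∧ M % 4 = 3) ∧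
      ∃ w z : ℚ, w ≠ 0 ∧ (l : ℚ) = M * w ^ 2 + n * z ^ 2 := by
  obtain ⟨l, hlgt, hl, hlM, hln, hlN, hl4, hJ⟩ :=
    exists_prime_jacobiSym_neg_mul_eq_one hM hn hN hMn hMN hnN
  have hM0 : M ≠ 0 := by rintro rfl; simp at hM
  have hMl : M.Coprime l := (Nat.coprime_of_lt_prime hM0 (by omega) hl).symm
  have hnl : n.Coprime l := (Nat.coprime_of_lt_prime hn.pos.ne' (by omega) hl).symm
  obtain ⟨t, ht⟩ := exists_dvd_mul_sq_add hl hMl hJ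
  obtain ⟨x, y, z, hz, h⟩ := legendre_exists_ternary_zero hM0 hn.pos.ne' hMn hnl hMl
    (r := 1) (s := 1) (by simpa using hlM.dvd) (by simpa using (hln.symm).dvd) ht
  have hzq : (z : ℚ) ≠ 0 := mod_cast hz
  have hq : (l : ℚ) = M * (x / z) ^ 2 + n * (y / z) ^ 2 := by
    field_simp
    exact_mod_cast h.symm
  refine ⟨l, hl, hlN, hl4, x / z, y / z, fun hx => ?_, hq⟩
  have hsq : IsSquare (l * n) := by
    rw [← Rat.isSquare_natCast_iff]
    refine ⟨n * (y / z), ?_⟩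
    rw [hx] at hq
    push_cast
    linear_combination (n : ℚ) * hq
  obtain ⟨d, hd⟩ := exists_sq_of_isSquare_mul_of_coprime hnl.symm hsq
  exact hl.prime.not_isSquare ⟨d, hd.trans (pow_two d)⟩

theorem exists_eq_sq_add_mul_sq {l q : ℕ} (hl : l.Prime) (hl_odd : Odd l) (hq : q % 4 = 3)
    (hlq : l ≡ 1 [MOD q]) : ∃ x y : ℚ, (l : ℚ) = x ^ 2 + q * y ^ 2 := by
  have hq_odd : Odd q := Nat.odd_iff.2 (by omega)
  have hJq : J(l | q) = 1 := by
    rw [jacobiSym_natCast_eq_of_modEq hlq, Nat.cast_one, jacobiSym.one_left]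
  have hJ : J(-((1 : ℕ) * q) | l) = 1 := by
    rw [Nat.cast_one, one_mul]
    rcases Nat.odd_mod_four_iff.1 (Nat.odd_iff.1 hl_odd) with hl4 | hl4
    · rw [jacobiSym.neg _ hl_odd, ZMod.χ₄_nat_one_mod_four hl4, one_mul,
        jacobiSym.quadratic_reciprocity_one_mod_four' hq_odd hl4, hJq]
    · rw [jacobiSym.neg _ hl_odd, ZMod.χ₄_nat_three_mod_four hl4,
        jacobiSym.quadratic_reciprocity_three_mod_four hq hl4, hJq, neg_one_mul,
        neg_neg]
  obtain ⟨t, ht⟩ := exists_dvd_mul_sq_add hl (Nat.coprime_one_left l) hJ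
  have hql : q.Coprime l := Nat.Coprime.symm (hlq.gcd_eq.trans (Nat.gcd_one_left q))
  obtain ⟨x, y, z, hz, h⟩ := legendre_exists_ternary_zero one_ne_zero (by omega)
    (Nat.coprime_one_left q) hql (Nat.coprime_one_left l) (r := 0) (s := 1)
    (by simp) (by simpa using hlq.symm.dvd) ht
  have hzq : (z : ℚ) ≠ 0 := mod_cast hz
  refine ⟨x / z, y / z, ?_⟩
  field_simp
  push_cast at h
  exact_mod_cast by linear_combination -h

/-! ### Robinson's definition of the integers -/

theorem den_dvd_of_mul_eq_intCast {D : ℕ} {q : ℚ} {m : ℤ} (hD : D ≠ 0) (h : D * q = m) :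
    q.den ∣ D := by
  have hq : q = Rat.divInt m D := by
    rw [Rat.divInt_eq_div]
    field_simp
    linear_combination h
  rw [hq]
  exact_mod_cast Rat.den_dvd m D

theorem not_dvd_den_of_descent {ι : Type*} [Finite ι] {r : ℕ} (hr : 1 < r) (v : ι → ℚ)
    (h : ∀ (D : ℕ) (V : ι → ℤ), (∀ i, D * v i = V i) → r ∣ D → ∀ i, (r : ℤ) ∣ V i) (i : ι) :
    ¬ r ∣ (v i).den := by
  classical
  have := Fintype.ofFinite ι
  have hex : ∃ D : ℕ, D ≠ 0 ∧ ∃ V : ι → ℤ, ∀ i, D * v i = V i := by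
    refine ⟨∏ i, (v i).den, Finset.prod_ne_zero_iff.2 fun i _ => (v i).den_ne_zero,
      fun i => (∏ j ∈ Finset.univ.erase i, (v j).den : ℕ) * (v i).num, fun i => ?_⟩
    rw [← Finset.mul_prod_erase _ _ (Finset.mem_univ i)]
    push_cast
    rw [← Rat.mul_den_eq_num (v i)]
    ring
  obtain ⟨hD, V, hV⟩ := Nat.find_spec hex
  refine fun hri => ?_
  obtain ⟨D', hD'⟩ : r ∣ Nat.find hex := hri.trans (den_dvd_of_mul_eq_intCast hD (hV i))
  choose V' hV' using h _ V hV ⟨D', hD'⟩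
  have hD'0 : D' ≠ 0 := by rintro rfl; exact hD hD'
  have hr0 : (r : ℚ) ≠ 0 := by positivity
  refine Nat.find_min hex (m := D') ?_ ⟨hD'0, V', fun j => mul_left_cancel₀ hr0 ?_⟩
  · rw [hD']
    exact lt_mul_left (Nat.pos_of_ne_zero hD'0) hr
  · have := hV j
    rw [hD', hV' j] at this
    push_cast at this
    rw [← mul_assoc, this]

/-- The solvability in a commutative semiring of the equation of Robinson's formula `phi`. -/
def RobinsonSolvable {R : Type*} [CommSemiring R] (a b k : R) : Prop :=
  ∃ x y z : R, 2 + a * b * k ^ 2 + b * z ^ 2 = x ^ 2 + a * y ^ 2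

theorem realize_phi_iff_robinsonSolvable (a b k : ℚ) :
    phi.Realize ![a, b, k] ↔ RobinsonSolvable a b k :=
  realize_phi _

theorem RobinsonSolvable.neg_swap {R : Type*} [CommRing R] {a b k : R}
    (h : RobinsonSolvable a b k) : RobinsonSolvable (-b) (-a) k := by
  obtain ⟨x, y, z, h⟩ := h
  exact ⟨x, z, y, by linear_combination h⟩

theorem RobinsonSolvable.intCast {R : Type*} [CommRing R] {a b : R} (h0 : RobinsonSolvable a b 0)
    (hs : ∀ k, RobinsonSolvable a b k → RobinsonSolvable a b (k + 1)) (m : ℤ) :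
    RobinsonSolvable a b (m : R) := by
  have hnat (j : ℕ) : RobinsonSolvable a b (j : R) := by
    induction j with
    | zero => simpa using h0
    | succ j ih => simpa using hs _ ih
  obtain ⟨j, rfl | rfl⟩ := m.eq_nat_or_neg
  · simpa using hnat j
  · simpa [RobinsonSolvable] using hnat j

theorem RobinsonSolvable.not_dvd_den {r : ℕ} (hr : 1 < r) {a b : ℤ} {k : ℚ}
    (h : ∀ D K X Y Z : ℤ, 2 * D ^ 2 + a * b * K ^ 2 + b * Z ^ 2 = X ^ 2 + a * Y ^ 2 →
      (r : ℤ) ∣ D → (r : ℤ) ∣ K ∧ (r : ℤ) ∣ X ∧ (r : ℤ) ∣ Y ∧ (r : ℤ) ∣ Z)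
    (hk : RobinsonSolvable (a : ℚ) b k) : ¬ r ∣ k.den := by
  obtain ⟨x, y, z, hxyz⟩ := hk
  refine not_dvd_den_of_descent hr ![k, x, y, z] (fun D V hV hrD => ?_) 0
  have hK : D * k = V 0 := hV 0
  have hX : D * x = V 1 := hV 1
  have hY : D * y = V 2 := hV 2
  have hZ : D * z = V 3 := hV 3
  have hom : 2 * (D : ℤ) ^ 2 + a * b * V 0 ^ 2 + b * V 3 ^ 2 = V 1 ^ 2 + a * V 2 ^ 2 := by
    qify
    rw [← hK, ← hX, ← hY, ← hZ]
    linear_combination (D : ℚ) ^ 2 * hxyz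
  obtain ⟨hK, hX, hY, hZ⟩ := h D _ _ _ _ hom (Int.natCast_dvd_natCast.2 hrD)
  intro i
  fin_cases i
  exacts [hK, hX, hY, hZ]

theorem RobinsonSolvable.not_dvd_den_of_jacobiSym {p : ℕ} (hp : p.Prime) {a b : ℤ} {k : ℚ}
    (hpb : (p : ℤ) ∣ b) (hpb' : ¬ (p : ℤ) ^ 2 ∣ b) (hJ : J(-a | p) = -1)
    (h : RobinsonSolvable (a : ℚ) b k) : ¬ p ∣ k.den := by
  have := Fact.mk hp
  refine h.not_dvd_den hp.one_lt fun D K X Y Z h hD => ?_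
  obtain ⟨c, rfl⟩ := hpb
  have hp0 : (p : ℤ) ≠ 0 := mod_cast hp.ne_zero
  have hpc : ¬ (p : ℤ) ∣ c := fun hc => hpb' (by rw [pow_two]; exact mul_dvd_mul_left _ hc)
  have hXY : (p : ℤ) ∣ X ^ 2 - -a * Y ^ 2 := by
    rw [show X ^ 2 - -a * Y ^ 2 = D * (2 * D) + p * (c * (a * K ^ 2 + Z ^ 2)) by
      linear_combination -h]
    exact (hD.mul_right _).add (dvd_mul_right _ _)
  obtain ⟨hX, hY⟩ := jacobiSym.prime_dvd_of_eq_neg_one hJ hXY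
  have hZK : (p : ℤ) ^ 2 ∣ p * (c * (Z ^ 2 - -a * K ^ 2)) := by
    rw [show p * (c * (Z ^ 2 - -a * K ^ 2)) = X ^ 2 + Y ^ 2 * a - D ^ 2 * 2 by
      linear_combination h]
    exact ((pow_dvd_pow_of_dvd hX 2).add ((pow_dvd_pow_of_dvd hY 2).mul_right _)).sub
      ((pow_dvd_pow_of_dvd hD 2).mul_right _)
  rw [pow_two, mul_dvd_mul_iff_left hp0] at hZK
  obtain ⟨hZ, hK⟩ := jacobiSym.prime_dvd_of_eq_neg_one hJ
    ((Nat.prime_iff_prime_int.1 hp |>.dvd_or_dvd hZK).resolve_left hpc)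
  exact ⟨hK, hX, hY, hZ⟩

theorem two_dvd_or_sq_emod_eight_eq_one (t : ℤ) : 2 ∣ t ∧ t ^ 2 % 4 = 0 ∨ t ^ 2 % 8 = 1 := by
  rcases Int.even_or_odd t with ht | ht
  · exact Or.inl ⟨ht.two_dvd, Int.emod_eq_zero_of_dvd (pow_dvd_pow_of_dvd ht.two_dvd 2)⟩
  · exact Or.inr (by have := Int.eight_dvd_sq_sub_one_of_odd ht; omega)

theorem RobinsonSolvable.not_two_dvd_den {k : ℚ} (h : RobinsonSolvable 1 3 k) : ¬ 2 ∣ k.den := by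
  have h' : RobinsonSolvable ((1 : ℤ) : ℚ) (3 : ℤ) k := by simpa using h
  refine h'.not_dvd_den one_lt_two fun D K X Y Z h hD => ?_
  have hD4 : D ^ 2 % 4 = 0 := Int.emod_eq_zero_of_dvd (pow_dvd_pow_of_dvd hD 2)
  push_cast
  have hK := two_dvd_or_sq_emod_eight_eq_one K
  have hX := two_dvd_or_sq_emod_eight_eq_one X
  have hY := two_dvd_or_sq_emod_eight_eq_one Y
  have hZ := two_dvd_or_sq_emod_eight_eq_one Z
  omega

/-- With `k = u / d` in lowest terms, clearing denominators turns the equation of `phi` into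
`M w² + b z² = x² + a y²` with `w ≠ 0` and `M = 2 d² + a b u²` this natural number. -/
def robinsonCoeff (a b : ℕ) (k : ℚ) : ℕ := 2 * k.den ^ 2 + a * b * k.num.natAbs ^ 2

theorem robinsonSolvable_of_robinsonCoeff_eq {a b : ℕ} {k w x y z : ℚ} (hw : w ≠ 0)
    (h : robinsonCoeff a b k * w ^ 2 + b * z ^ 2 = x ^ 2 + a * y ^ 2) :
    RobinsonSolvable (a : ℚ) b k := by
  have hd : (k.den : ℚ) ≠ 0 := mod_cast k.den_ne_zero
  have hM : (robinsonCoeff a b k : ℚ) = (2 + a * b * k ^ 2) * k.den ^ 2 := by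
    have hnum : (k.num.natAbs : ℚ) ^ 2 = (k * k.den) ^ 2 := by
      rw [Rat.mul_den_eq_num, Nat.cast_natAbs, Int.cast_abs, sq_abs]
    rw [robinsonCoeff]
    push_cast
    rw [hnum]
    ring
  refine ⟨x / (w * k.den), y / (w * k.den), z / (w * k.den), ?_⟩
  rw [hM] at h
  field_simp
  linear_combination h

theorem not_four_dvd_robinsonCoeff {a b : ℕ} (hab : Odd (a * b)) (k : ℚ) :
    ¬ 4 ∣ robinsonCoeff a b k := by
  intro h
  have hu : 2 ∣ k.num.natAbs := by
    have : 2 ∣ a * b * k.num.natAbs ^ 2 :=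
      (Nat.dvd_add_right (dvd_mul_right 2 _)).1 ((by decide : 2 ∣ 4).trans h)
    exact Nat.prime_two.dvd_of_dvd_pow (hab.coprime_two_left.dvd_of_dvd_mul_left this)
  have hd : 2 ∣ k.den := by
    have : 2 * 2 ∣ 2 * k.den ^ 2 :=
      (Nat.dvd_add_left ((pow_dvd_pow_of_dvd hu 2).mul_left _)).1 h
    exact Nat.prime_two.dvd_of_dvd_pow ((mul_dvd_mul_iff_left two_ne_zero).1 this)
  exact Nat.not_coprime_of_dvd_of_dvd one_lt_two hu hd k.reduced

theorem robinsonCoeff_coprime {a b r : ℕ} (hr : r.Prime) (hr_odd : Odd r) (hrab : r ∣ a * b)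
    {k : ℚ} (hk : ¬ r ∣ k.den) : (robinsonCoeff a b k).Coprime r := by
  refine (hr.coprime_iff_not_dvd.2 fun h => ?_).symm
  have : r ∣ 2 * k.den ^ 2 := (Nat.dvd_add_left (hrab.mul_right _)).1 h
  exact hk (hr.dvd_of_dvd_pow (hr_odd.coprime_two_right.dvd_of_dvd_mul_left this))

theorem robinsonSolvable_one_three_iff (k : ℚ) :
    RobinsonSolvable 1 3 k ↔ ¬ 2 ∣ k.den ∧ ¬ 3 ∣ k.den := by
  constructor
  · intro h
    have h3 : RobinsonSolvable ((1 : ℤ) : ℚ) (3 : ℤ) k := by simpa using h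
    have hJ : J(-1 | 3) = -1 := by rw [jacobiSym.at_neg_one (by decide)]; rfl
    exact ⟨h.not_two_dvd_den,
      h3.not_dvd_den_of_jacobiSym Nat.prime_three (by norm_num) (by norm_num) hJ⟩
  · rintro ⟨h2, h3⟩
    have hM4 : robinsonCoeff 1 3 k % 4 ≠ 3 := by
      have hd := two_dvd_or_sq_emod_eight_eq_one k.den
      have hu := two_dvd_or_sq_emod_eight_eq_one k.num
      have hM : (robinsonCoeff 1 3 k : ℤ) = 2 * (k.den : ℤ) ^ 2 + 3 * k.num ^ 2 := by
        simp [robinsonCoeff]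
      omega
    obtain ⟨l, hl, -, hl4, w, z, hw, hlw⟩ := exists_prime_eq_mul_sq_add_mul_sq
      (not_four_dvd_robinsonCoeff (a := 1) (b := 3) (by decide) k) (by decide) odd_one
      (robinsonCoeff_coprime Nat.prime_three (by decide) (by decide) h3)
      (Nat.coprime_one_right _) (Nat.coprime_one_right _)
    have := Fact.mk hl
    obtain ⟨x, y, hxy⟩ := Nat.Prime.sq_add_sq (p := l) (by omega)
    have := robinsonSolvable_of_robinsonCoeff_eq (x := x) (y := y) hw
      (hlw.symm.trans (by rw [← hxy]; push_cast; ring))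
    simpa using this

theorem robinsonSolvable_prime_iff {p q : ℕ} (hp : p.Prime) (hq : q.Prime) (hp_odd : Odd p)
    (hq4 : q % 4 = 3) (hqp : J(-q | p) = -1) (hpq : J(p | q) = -1) (k : ℚ) :
    RobinsonSolvable (q : ℚ) p k ↔ ¬ p ∣ k.den ∧ ¬ q ∣ k.den := by
  have not_sq_dvd {r : ℕ} (hr : r.Prime) : ¬ (r : ℤ) ^ 2 ∣ r := fun h =>
    (Nat.prime_iff_prime_int.1 hr).not_isUnit
      ((Nat.prime_iff_prime_int.1 hr).squarefree r (by rwa [← pow_two]))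
  have hcop : p.Coprime q := by
    have : NeZero q := ⟨hq.ne_zero⟩
    by_contra h
    rw [(jacobiSym.eq_zero_iff_not_coprime (a := p) (b := q)).2 h] at hpq
    exact absurd hpq (by decide)
  constructor
  · intro h
    have hp' : RobinsonSolvable ((q : ℤ) : ℚ) (p : ℤ) k := by simpa using h
    have hq' : RobinsonSolvable ((-p : ℤ) : ℚ) (-q : ℤ) k := by simpa using h.neg_swap
    exact ⟨hp'.not_dvd_den_of_jacobiSym hp dvd_rfl (not_sq_dvd hp) hqp,
      hq'.not_dvd_den_of_jacobiSym hq (by simp) (by simpa using not_sq_dvd hq) (by simpa using hpq)⟩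
  · rintro ⟨hkp, hkq⟩
    have hq_odd : Odd q := Nat.odd_iff.2 (by omega)
    obtain ⟨l, hl, hlq, hl4, w, z, hw, hlw⟩ := exists_prime_eq_mul_sq_add_mul_sq
      (not_four_dvd_robinsonCoeff (hq_odd.mul hp_odd) k) hp_odd hq_odd
      (robinsonCoeff_coprime hp hp_odd (dvd_mul_left p q) hkp)
      (robinsonCoeff_coprime hq hq_odd (dvd_mul_right q p) hkq) hcop
    obtain ⟨x, y, hxy⟩ := exists_eq_sq_add_mul_sq hl (Nat.odd_iff.2 (by omega)) hq4 hlq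
    exact robinsonSolvable_of_robinsonCoeff_eq hw (hlw.symm.trans hxy)

-- The conditions on `q` say that the quaternion algebra over `ℚ` with parameters `-q` and `p`
-- ramifies exactly at `p` and `q`.
theorem exists_prime_jacobiSym_eq_neg_one {p : ℕ} (hp : p.Prime) (hp_odd : Odd p) :
    ∃ q : ℕ, q.Prime ∧ q % 4 = 3 ∧ J(-q | p) = -1 ∧ J(p | q) = -1 := by
  have := Fact.mk hp
  obtain ⟨g, hg⟩ := FiniteField.exists_nonsquare (F := ZMod p) (by
    rw [ZMod.ringChar_zmod_n]; rintro rfl; exact absurd hp_odd (by decide))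
  obtain ⟨n, hn⟩ := ZMod.natCast_zmod_surjective (-g)
  have hnp : n.Coprime p := by
    refine (hp.coprime_iff_not_dvd.2 fun h => hg ?_).symm
    rw [← ZMod.natCast_eq_zero_iff, hn, neg_eq_zero] at h
    exact h ▸ IsSquare.zero
  obtain ⟨q, -, hq, hmod⟩ := exists_prime_gt_and_forall_modEq Prod.fst Prod.snd [(3, 4), (n, p)]
    (by simpa [Function.onFun] using hp_odd.coprime_two_left.pow_left 2)
    (by simp [hp.ne_zero]) (by simpa using ⟨by decide, hnp⟩) 0
  simp only [List.forall_mem_cons, List.not_mem_nil] at hmod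
  obtain ⟨hq4, hqn, -⟩ := hmod
  replace hq4 : q % 4 = 3 := hq4
  have hJ : J(-q | p) = -1 := by
    rw [ZMod.nonsquare_iff_jacobiSym_eq_neg_one]
    push_cast
    rwa [(ZMod.natCast_eq_natCast_iff _ _ _).2 hqn, hn, neg_neg]
  refine ⟨q, hq, hq4, hJ, ?_⟩
  rw [jacobiSym.neg _ hp_odd] at hJ
  rcases Nat.odd_mod_four_iff.1 (Nat.odd_iff.1 hp_odd) with h | h
  · rwa [ZMod.χ₄_nat_one_mod_four h, one_mul,
      ← jacobiSym.quadratic_reciprocity_one_mod_four h (Nat.odd_iff.2 (by omega))] at hJ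
  · rwa [ZMod.χ₄_nat_three_mod_four h, neg_one_mul,
      ← jacobiSym.quadratic_reciprocity_three_mod_four h hq4] at hJ

theorem not_dvd_den_of_robinsonSolvable_iff {n : ℚ} {a b : ℚ} {r s : ℕ} (hr : 1 < r)
    (hs : 1 < s) (hab : ∀ k, RobinsonSolvable a b k ↔ ¬ r ∣ k.den ∧ ¬ s ∣ k.den)
    (h : RobinsonSolvable a b 0 ∧ (∀ k, RobinsonSolvable a b k → RobinsonSolvable a b (k + 1)) →
      RobinsonSolvable a b n) : ¬ r ∣ n.den := by
  refine ((hab n).1 (h ⟨(hab 0).2 ?_, fun k hk => (hab _).2 ?_⟩)).1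
  · simp [hr.ne', hs.ne']
  · have hden : (k + 1).den = k.den := mod_cast Rat.add_natCast_den k 1
    rw [hden]
    exact (hab k).1 hk

theorem realize_psi_iff_exists_int (n : ℚ) : psi.Realize (fun _ => n) ↔ ∃ m : ℤ, (m : ℚ) = n := by
  simp only [realize_psi, realize_phi_iff_robinsonSolvable]
  constructor
  · intro h
    suffices hden : n.den = 1 from ⟨n.num, Rat.coe_int_num_of_den_eq_one hden⟩
    by_contra hne
    obtain ⟨p, hp, hdvd⟩ := Nat.exists_prime_and_dvd hne
    refine absurd hdvd ?_
    rcases hp.eq_two_or_odd' with rfl | hp_odd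
    · exact not_dvd_den_of_robinsonSolvable_iff one_lt_two (by decide)
        robinsonSolvable_one_three_iff (h 1 3 (by norm_num))
    · obtain ⟨q, hq, hq4, hqp, hpq⟩ := exists_prime_jacobiSym_eq_neg_one hp hp_odd
      exact not_dvd_den_of_robinsonSolvable_iff hp.one_lt hq.one_lt
        (robinsonSolvable_prime_iff hp hq hp_odd hq4 hqp hpq)
        (h q p ⟨mod_cast hq.ne_zero, mod_cast hp.ne_zero⟩)
  · rintro ⟨m, rfl⟩ a b - ⟨h0, hs⟩
    exact h0.intCast hs m

/-! ### Arithmetical relations -/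

section Arithmetical

open FirstOrder FirstOrder.Language

/-- The formula `ψ(x) ∧ ∃ a b c d, x = a² + b² + c² + d²`, which defines `ℕ` in `ℚ`. -/
def isNat : Lring.Formula (Fin 1) :=
  psi ⊓ ∃' ∃' ∃' ∃' ((Term.var (Sum.inl 0) : Lring.Term (Fin 1 ⊕ Fin 4)) ='
    (&0 * &0 + &1 * &1 + &2 * &2 + &3 * &3))

theorem realize_isNat_iff_sum_four_squares (x : ℚ) :
    isNat.Realize (fun _ => x) ↔
      psi.Realize (fun _ => x) ∧ ∃ a b c d : ℚ, x = a * a + b * b + c * c + d * d := by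
  simp only [isNat, Formula.Realize, BoundedFormula.realize_inf, BoundedFormula.realize_ex,
    BoundedFormula.realize_bdEqual, realize_add, realize_mul, Term.realize_var, Sum.elim_inl]
  rfl

theorem realize_isNat_iff_exists_nat (x : ℚ) :
    isNat.Realize (fun _ => x) ↔ ∃ n : ℕ, (n : ℚ) = x := by
  rw [realize_isNat_iff_sum_four_squares, realize_psi_iff_exists_int]
  constructor
  · rintro ⟨⟨m, rfl⟩, a, b, c, d, h⟩
    have hm : (0 : ℚ) ≤ m := by
      rw [h]
      linarith [mul_self_nonneg a, mul_self_nonneg b, mul_self_nonneg c, mul_self_nonneg d]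
    lift m to ℕ using mod_cast hm
    exact ⟨m, by simp⟩
  · rintro ⟨n, rfl⟩
    obtain ⟨a, b, c, d, h⟩ := Nat.sum_four_squares n
    refine ⟨⟨n, by simp⟩, a, b, c, d, ?_⟩
    exact_mod_cast (by linarith : n = a * a + b * b + c * c + d * d)

/-- A relation between natural numbers is arithmetical if some formula of the language of rings,
interpreted in `ℚ`, defines it on tuples of natural numbers. -/
def Arithmetical {α : Type} (P : (α → ℕ) → Prop) : Prop :=
  ∃ φ : Lring.Formula α, ∀ v, φ.Realize (fun i => (v i : ℚ)) ↔ P v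

/-- A function of natural numbers is arithmetical if its graph is; the variable `Sum.inr ()` stands
for the value. -/
def ArithmeticalFun {α : Type} (f : (α → ℕ) → ℕ) : Prop :=
  Arithmetical fun w : α ⊕ Unit → ℕ => f (fun i => w (.inl i)) = w (.inr ())

variable {α β : Type} {f g h : (α → ℕ) → ℕ} {P Q : (α → ℕ) → Prop}

namespace Arithmetical

theorem not : Arithmetical P → Arithmetical fun v => ¬ P v := by
  rintro ⟨φ, hφ⟩
  exact ⟨φ.not, fun v => by rw [Formula.realize_not, hφ]⟩

theorem and : Arithmetical P → Arithmetical Q → Arithmetical fun v => P v ∧ Q v := by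
  rintro ⟨φ, hφ⟩ ⟨ψ, hψ⟩
  exact ⟨φ ⊓ ψ, fun v => by rw [Formula.realize_inf, hφ, hψ]⟩

theorem of_iff (hP : Arithmetical P) (h : ∀ v, Q v ↔ P v) : Arithmetical Q := by
  rwa [show Q = P from funext fun v => propext (h v)]

theorem or (hP : Arithmetical P) (hQ : Arithmetical Q) : Arithmetical fun v => P v ∨ Q v :=
  (hP.not.and hQ.not).not.of_iff fun v => by tauto

theorem imp (hP : Arithmetical P) (hQ : Arithmetical Q) : Arithmetical fun v => P v → Q v :=
  (hP.and hQ.not).not.of_iff fun v => by tauto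

theorem relabel (e : α → β) :
    Arithmetical P → Arithmetical fun w : β → ℕ => P fun i => w (e i) := by
  rintro ⟨φ, hφ⟩
  exact ⟨φ.relabel e, fun w => Formula.realize_relabel.trans (hφ _)⟩

theorem ex {P : (α → ℕ) → ℕ → Prop}
    (hP : Arithmetical fun w : α ⊕ Unit → ℕ => P (fun i => w (.inl i)) (w (.inr ()))) :
    Arithmetical fun v => ∃ x, P v x := by
  obtain ⟨φ, hφ⟩ := hP
  have realize_elim (v : α → ℕ) (x : ℕ) :
      φ.Realize (Sum.elim (fun i => (v i : ℚ)) fun _ => (x : ℚ)) ↔ P v x := by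
    refine Iff.trans (iff_of_eq (congrArg φ.Realize ?_)) (hφ (Sum.elim v fun _ => x))
    exact (Sum.comp_elim (Nat.cast : ℕ → ℚ) v fun _ => x).symm
  refine ⟨Formula.iExs Unit (isNat.relabel (fun _ => Sum.inr ()) ⊓ φ), fun v => ?_⟩
  simp only [Formula.realize_iExs, Formula.realize_inf, Formula.realize_relabel]
  constructor
  · rintro ⟨q, hq, hφq⟩
    obtain ⟨x, hx⟩ := (realize_isNat_iff_exists_nat (q ())).1 hq
    obtain rfl : q = fun _ => (x : ℚ) := funext fun _ => hx.symm
    exact ⟨x, (realize_elim v x).1 hφq⟩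
  · rintro ⟨x, hx⟩
    exact ⟨fun _ => x, (realize_isNat_iff_exists_nat x).2 ⟨x, rfl⟩, (realize_elim v x).2 hx⟩

theorem all {P : (α → ℕ) → ℕ → Prop}
    (hP : Arithmetical fun w : α ⊕ Unit → ℕ => P (fun i => w (.inl i)) (w (.inr ()))) :
    Arithmetical fun v => ∀ x, P v x :=
  hP.not.ex (P := fun v x => ¬ P v x) |>.not.of_iff fun v => by push Not; rfl

theorem comp {P : (α → ℕ) → ℕ → Prop}
    (hP : Arithmetical fun w : α ⊕ Unit → ℕ => P (fun i => w (.inl i)) (w (.inr ())))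
    (hf : ArithmeticalFun f) : Arithmetical fun v => P v (f v) :=
  (ex (P := fun v x => f v = x ∧ P v x) (hf.and hP)).of_iff fun v => by simp

theorem eq (hf : ArithmeticalFun f) (hg : ArithmeticalFun g) :
    Arithmetical fun v => f v = g v :=
  comp hf hg

end Arithmetical

namespace ArithmeticalFun

theorem relabel (e : α → β) (hf : ArithmeticalFun f) :
    ArithmeticalFun fun w : β → ℕ => f fun i => w (e i) :=
  Arithmetical.relabel (Sum.map e id) hf

theorem of_realize (t : Lring.Term α) (ht : ∀ v, t.realize (fun i => (v i : ℚ)) = f v) :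
    ArithmeticalFun f :=
  ⟨(t.relabel Sum.inl).equal (Term.var (Sum.inr ())), fun w => by
    rw [Formula.realize_equal, Term.realize_relabel, Term.realize_var]
    exact (congrArg (· = (w (Sum.inr ()) : ℚ)) (ht fun i => w (Sum.inl i))).to_iff.trans
      Nat.cast_inj⟩

theorem var (i : α) : ArithmeticalFun fun v => v i :=
  of_realize (Term.var i) fun _ => rfl

theorem zero : ArithmeticalFun fun _ : α → ℕ => 0 :=
  of_realize 0 fun v => by rw [realize_zero, Nat.cast_zero]

theorem one : ArithmeticalFun fun _ : α → ℕ => 1 :=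
  of_realize 1 fun v => by rw [realize_one, Nat.cast_one]

theorem comp {g : (α → ℕ) → ℕ → ℕ}
    (hg : ArithmeticalFun fun w : α ⊕ Unit → ℕ => g (fun i => w (.inl i)) (w (.inr ())))
    (hf : ArithmeticalFun f) : ArithmeticalFun fun v => g v (f v) :=
  Arithmetical.comp (α := α ⊕ Unit) (f := fun w => f fun i => w (.inl i))
    (P := fun w x => g (fun i => w (.inl i)) x = w (.inr ()))
    (Arithmetical.relabel (Sum.elim (Sum.map Sum.inl id) fun _ => .inl (.inr ())) hg)
    (hf.relabel Sum.inl)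

theorem comp₂ {g : ℕ → ℕ → ℕ} (hg : ArithmeticalFun fun v : Fin 2 → ℕ => g (v 0) (v 1))
    (hf : ArithmeticalFun f) (hh : ArithmeticalFun h) :
    ArithmeticalFun fun v => g (f v) (h v) :=
  comp (g := fun v x => g x (h v))
    (comp (α := α ⊕ Unit) (g := fun w y => g (w (.inr ())) y)
      (hg.relabel ![Sum.inl (Sum.inr ()), Sum.inr ()]) (hh.relabel Sum.inl)) hf

theorem add (hf : ArithmeticalFun f) (hg : ArithmeticalFun g) :
    ArithmeticalFun fun v => f v + g v :=
  comp₂ (of_realize (Term.var 0 + Term.var 1) fun v => by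
    rw [realize_add, Nat.cast_add]; rfl) hf hg

theorem mul (hf : ArithmeticalFun f) (hg : ArithmeticalFun g) :
    ArithmeticalFun fun v => f v * g v :=
  comp₂ (of_realize (Term.var 0 * Term.var 1) fun v => by
    rw [realize_mul, Nat.cast_mul]; rfl) hf hg

end ArithmeticalFun

theorem Arithmetical.lt (hf : ArithmeticalFun f) (hg : ArithmeticalFun g) :
    Arithmetical fun v => f v < g v := by
  refine (ex (P := fun v k => f v + k + 1 = g v) ?_).of_iff fun v => ?_
  · exact eq (((hf.relabel _).add (.var _)).add .one) (hg.relabel _)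
  · rw [Nat.lt_iff_add_one_le, le_iff_exists_add]
    exact exists_congr fun k => by rw [add_right_comm, eq_comm]

theorem exists_forall_le_beta_eq (s : ℕ → ℕ) (n : ℕ) : ∃ c, ∀ i ≤ n, Nat.beta c i = s i := by
  refine ⟨Nat.unbeta (List.ofFn fun i : Fin (n + 1) => s i), fun i hi => ?_⟩
  have := Nat.beta_unbeta_coe (List.ofFn fun i : Fin (n + 1) => s i)
    ⟨i, by rw [List.length_ofFn]; omega⟩
  exact this.trans (by simp only [Fin.getElem_fin, List.getElem_ofFn])

theorem natRec_eq_iff_exists_beta {a m y : ℕ} {g : ℕ → ℕ → ℕ} :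
    Nat.rec a g m = y ↔ ∃ c, Nat.beta c 0 = a ∧ Nat.beta c m = y ∧
      ∀ i < m, Nat.beta c (i + 1) = g i (Nat.beta c i) := by
  constructor
  · rintro rfl
    obtain ⟨c, hc⟩ := exists_forall_le_beta_eq (fun i => Nat.rec a g i) m
    refine ⟨c, hc 0 m.zero_le, hc m le_rfl, fun i hi => ?_⟩
    rw [hc (i + 1) hi, hc i hi.le]
  · rintro ⟨c, rfl, rfl, hc⟩
    suffices ∀ i ≤ m, Nat.rec (Nat.beta c 0) g i = Nat.beta c i from this m le_rfl
    intro i hi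
    induction i with
    | zero => rfl
    | succ i ih => rw [hc i hi, ← ih (Nat.le_of_succ_le hi)]

namespace ArithmeticalFun

theorem pair (hf : ArithmeticalFun f) (hg : ArithmeticalFun g) :
    ArithmeticalFun fun v => Nat.pair (f v) (g v) := by
  have hf' := hf.relabel (Sum.inl : α → α ⊕ Unit)
  have hg' := hg.relabel (Sum.inl : α → α ⊕ Unit)
  refine (((Arithmetical.lt hf' hg').and (.eq ((hg'.mul hg').add hf') (.var (.inr ())))).or
    ((Arithmetical.lt hf' hg').not.and
      (.eq (((hf'.mul hf').add hf').add hg') (.var (.inr ()))))).of_iff fun w => ?_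
  simp only [Nat.pair]
  split_ifs with hlt <;> simp [hlt]

theorem unpair_fst (hf : ArithmeticalFun f) : ArithmeticalFun fun v => (f v).unpair.1 := by
  refine (Arithmetical.ex (P := fun w y => Nat.pair (w (.inr ())) y = f fun i => w (.inl i))
    (.eq (.pair (.var _) (.var _)) (hf.relabel _))).of_iff fun w => ?_
  constructor
  · intro h
    exact ⟨_, by rw [← h, Nat.pair_unpair]⟩
  · rintro ⟨y, hy⟩
    simp [← hy]

theorem unpair_snd (hf : ArithmeticalFun f) : ArithmeticalFun fun v => (f v).unpair.2 := by
  refine (Arithmetical.ex (P := fun w y => Nat.pair y (w (.inr ())) = f fun i => w (.inl i))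
    (.eq (.pair (.var _) (.var _)) (hf.relabel _))).of_iff fun w => ?_
  constructor
  · intro h
    exact ⟨_, by rw [← h, Nat.pair_unpair]⟩
  · rintro ⟨y, hy⟩
    simp [← hy]

theorem mod (hf : ArithmeticalFun f) (hg : ArithmeticalFun g) :
    ArithmeticalFun fun v => f v % g v := by
  have hf' := hf.relabel (Sum.inl : α → α ⊕ Unit)
  have hg' := hg.relabel (Sum.inl : α → α ⊕ Unit)
  have hquot : Arithmetical fun w : α ⊕ Unit → ℕ =>
      ∃ k, f (fun i => w (.inl i)) = g (fun i => w (.inl i)) * k + w (.inr ()) :=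
    .ex (.eq (hf'.relabel _) (((hg'.relabel _).mul (.var _)).add (.var _)))
  exact (((Arithmetical.eq hg' .zero).and (.eq hf' (.var (.inr ())))).or
    ((Arithmetical.lt (.var (.inr ())) hg').and hquot)).of_iff fun w => Nat.mod_eq_iff

theorem beta (hf : ArithmeticalFun f) (hg : ArithmeticalFun g) :
    ArithmeticalFun fun v => Nat.beta (f v) (g v) :=
  hf.unpair_fst.mod (((hg.add .one).mul hf.unpair_snd).add .one)

theorem natRec {g : (α → ℕ) → ℕ → ℕ → ℕ} {n : (α → ℕ) → ℕ} (hf : ArithmeticalFun f)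
    (hg : ArithmeticalFun fun w : (α ⊕ Unit) ⊕ Unit → ℕ =>
      g (fun i => w (.inl (.inl i))) (w (.inl (.inr ()))) (w (.inr ())))
    (hn : ArithmeticalFun n) : ArithmeticalFun fun v => Nat.rec (f v) (g v) (n v) := by
  have hstep : Arithmetical fun w : ((α ⊕ Unit) ⊕ Unit) ⊕ Unit → ℕ =>
      Nat.beta (w (.inl (.inr ()))) (w (.inr ()) + 1) = g (fun i => w (.inl (.inl (.inl i))))
        (w (.inr ())) (Nat.beta (w (.inl (.inr ()))) (w (.inr ()))) :=
    .eq (.beta (.var _) (.add (.var _) .one)) <|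
      comp (α := ((α ⊕ Unit) ⊕ Unit) ⊕ Unit)
        (g := fun w y => g (fun i => w (.inl (.inl (.inl i)))) (w (.inr ())) y)
        (hg.relabel (Sum.map (Sum.map (Sum.inl ∘ Sum.inl) id) id)) (.beta (.var _) (.var _))
  refine (Arithmetical.ex (P := fun w c => Nat.beta c 0 = f (fun i => w (.inl i)) ∧
      Nat.beta c (n fun i => w (.inl i)) = w (.inr ()) ∧
      ∀ i, i < n (fun i => w (.inl i)) →
        Nat.beta c (i + 1) = g (fun i => w (.inl i)) i (Nat.beta c i)) ?_).of_iff
    fun w => natRec_eq_iff_exists_beta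
  exact (Arithmetical.eq (.beta (.var _) .zero) (hf.relabel _)).and
    ((Arithmetical.eq (.beta (.var _) (hn.relabel _)) (.var _)).and
      (.all ((Arithmetical.lt (.var _) (hn.relabel _)).imp hstep)))

theorem primrec {F : ℕ → ℕ} (hF : Nat.Primrec F) {α : Type} {f : (α → ℕ) → ℕ}
    (hf : ArithmeticalFun f) : ArithmeticalFun fun v => F (f v) := by
  induction hF generalizing α with
  | zero => exact zero
  | succ => exact hf.add one
  | left => exact hf.unpair_fst
  | right => exact hf.unpair_snd
  | pair _ _ ihF ihG => exact (ihF hf).pair (ihG hf)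
  | comp _ _ ihF ihG => exact ihF (ihG hf)
  | prec _ _ ihF ihG =>
    refine natRec (ihF hf.unpair_fst) (ihG ?_) hf.unpair_snd
    exact (hf.unpair_fst.relabel _).pair ((var _).pair (var _))

end ArithmeticalFun

theorem exists_primrec_dom_iff {p : ℕ → Prop} (hp : REPred p) :
    ∃ F : ℕ → ℕ, Nat.Primrec F ∧ ∀ n, p n ↔ ∃ k, F (Nat.pair k n) ≠ 0 := by
  obtain ⟨c, hc⟩ := Nat.Partrec.Code.exists_code.1
    (Partrec.nat_iff.1 (hp.map (Computable.const 0).to₂))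
  have hprim : Primrec fun x : ℕ =>
      Encodable.encode (Nat.Partrec.Code.evaln x.unpair.1 c x.unpair.2) :=
    Primrec.encode.comp (Nat.Partrec.Code.primrec_evaln.comp
      ((((Primrec.fst.comp .unpair).pair (.const c)).pair (Primrec.snd.comp .unpair))))
  refine ⟨_, Primrec.nat_iff.1 hprim, fun n => ?_⟩
  have hdom : p n ↔ (c.eval n).Dom := by
    rw [hc]
    exact ⟨fun h => ⟨h, trivial⟩, fun ⟨h, _⟩ => h⟩
  simp only [hdom, Part.dom_iff_mem, Nat.Partrec.Code.evaln_complete, Nat.unpair_pair]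
  rw [exists_comm]
  refine exists_congr fun k => ?_
  cases Nat.Partrec.Code.evaln k c n <;> simp

theorem Arithmetical.of_rePred {p : ℕ → Prop} (hp : REPred p) (hf : ArithmeticalFun f) :
    Arithmetical fun v => p (f v) := by
  obtain ⟨F, hF, hpF⟩ := exists_primrec_dom_iff hp
  refine (ex (P := fun v k => F (Nat.pair k (f v)) ≠ 0) ?_).of_iff fun v => hpF (f v)
  exact (eq (.primrec hF (.pair (.var _) (hf.relabel _))) .zero).not

end Arithmetical

/-! ### Undecidability -/

section Undecidability

open FirstOrder FirstOrder.Language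

/-- The numeral `1 + (1 + (⋯ + 0))` of a natural number, as a term in which the single bound
variable of `instanceAt` may occur. -/
def numeral (n : ℕ) : Lring.Term (Empty ⊕ Fin 1) :=
  Nat.rec 0 (fun _ t => 1 + t) n

theorem realize_numeral (n : ℕ) (v : Empty ⊕ Fin 1 → ℚ) : (numeral n).realize v = n := by
  induction n with
  | zero => rw [Nat.cast_zero]; rfl
  | succ n ih =>
    rw [show numeral (n + 1) = 1 + numeral n from rfl, realize_add, ih, realize_one, add_comm,
      Nat.cast_succ]

theorem termString_numeral (n : ℕ) : termString (numeral n) =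
    Nat.rec [Symb.zero] (fun _ l => Symb.add :: Symb.one :: l) n := by
  induction n with
  | zero => rfl
  | succ n ih => exact congrArg (Symb.add :: Symb.one :: ·) ih

/-- The sentence `∀ x, x = n → θ(x)`, in which `n` occurs only through its numeral, so that its
string is visibly a computable function of `n`. -/
def instanceAt (θ : Lring.BoundedFormula Empty 1) (n : ℕ) : Lring.Sentence :=
  ∀' (((&0 : Lring.Term (Empty ⊕ Fin 1)) =' numeral n) ⟹ θ)

theorem realize_instanceAt (θ : Lring.BoundedFormula Empty 1) (n : ℕ) :
    ℚ ⊨ instanceAt θ n ↔ θ.Realize default (fun _ => (n : ℚ)) := by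
  simp only [instanceAt, Sentence.Realize, Formula.Realize, BoundedFormula.realize_all,
    BoundedFormula.realize_imp, BoundedFormula.realize_bdEqual, realize_numeral]
  have snoc_eq (e : Fin 0 → ℚ) (x : ℚ) : Fin.snoc (α := fun _ : Fin 1 => ℚ) e x = fun _ => x :=
    funext fun i => by fin_cases i; rfl
  simp only [snoc_eq, Function.comp_apply, Term.realize_var, Sum.elim_inr, forall_eq]
  exact iff_of_eq (congrArg₂ θ.Realize (Subsingleton.elim _ _) rfl)

theorem realize_relabel_inr (θ : Lring.Formula (Fin 1)) (x : ℚ) :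
    (BoundedFormula.relabel (k := 0) (Sum.inr : Fin 1 → Empty ⊕ Fin 1) θ).Realize default
      (fun _ => x) ↔ θ.Realize fun _ => x := by
  rw [BoundedFormula.realize_relabel]
  exact iff_of_eq (congrArg₂ _ rfl (Subsingleton.elim _ _))

theorem computable_formulaString_instanceAt (θ : Lring.BoundedFormula Empty 1) :
    Computable fun n => formulaString (instanceAt θ n) := by
  have formulaString_eq : (fun n => formulaString (instanceAt θ n)) = fun n =>
      ([Symb.all, Symb.var, Symb.imp, Symb.eq, Symb.var] ++
        (Nat.rec [Symb.zero] (fun _ l => Symb.add :: Symb.one :: l) n : List Symb)) ++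
          formulaString θ := by
    funext n
    rw [← termString_numeral]
    rfl
  rw [formulaString_eq]
  have hrec : Primrec fun n : ℕ =>
      (Nat.rec [Symb.zero] (fun _ l => Symb.add :: Symb.one :: l) n : List Symb) :=
    Primrec.nat_rec₁ _ (Primrec.list_cons.comp (.const _)
      (Primrec.list_cons.comp (.const _) Primrec.snd))
  exact (Primrec.list_append.comp (Primrec.list_append.comp (.const _) hrec) (.const _)).to_comp

theorem Arithmetical.computablePred {p : ℕ → Prop}
    (hp : Arithmetical fun v : Fin 1 → ℕ => p (v 0))
    (hT : TheoryDecidable (Lring.completeTheory ℚ)) : ComputablePred p := by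
  obtain ⟨θ, hθ⟩ := hp
  obtain ⟨f, hf, hdec⟩ := hT
  let σ (n : ℕ) : Lring.Sentence := instanceAt (BoundedFormula.relabel (k := 0) Sum.inr θ) n
  have hσ (n : ℕ) : f (formulaString (σ n)) = true ↔ p n := by
    rw [hdec, mem_completeTheory, realize_instanceAt, realize_relabel_inr]
    exact hθ fun _ => n
  exact ComputablePred.computable_iff.2 ⟨fun n => f (formulaString (σ n)),
    hf.comp (computable_formulaString_instanceAt _), funext fun n => propext (hσ n).symm⟩

theorem not_theoryDecidable_completeTheory_rat :
    ¬ TheoryDecidable (Lring.completeTheory ℚ) := by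
  intro hT
  have hre : REPred fun e : ℕ => ((Denumerable.ofNat Nat.Partrec.Code e).eval 0).Dom :=
    (Nat.Partrec.Code.eval_part.comp (Computable.ofNat _) (Computable.const 0)).dom_re
  have hhalt : ComputablePred fun e : ℕ => ((Denumerable.ofNat Nat.Partrec.Code e).eval 0).Dom :=
    (Arithmetical.of_rePred hre (.var 0)).computablePred hT
  obtain ⟨f, hf, hfe⟩ := ComputablePred.computable_iff.1 hhalt
  refine ComputablePred.halting_problem 0 (ComputablePred.computable_iff.2
    ⟨fun c => f (Encodable.encode c), hf.comp Computable.encode, funext fun c => ?_⟩)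
  rw [← congrFun hfe (Encodable.encode c), Denumerable.ofNat_encode]

end Undecidability

end RingTheoryOfRat

theorem mainTheorem6 :
    (∀ n : ℚ, RingTheoryOfRat.psi.Realize (fun _ => n) ↔ ∃ m : ℤ, (m : ℚ) = n) ∧
      ¬ RingTheoryOfRat.TheoryDecidable (RingTheoryOfRat.Lring.completeTheory ℚ) :=
  ⟨RingTheoryOfRat.realize_psi_iff_exists_int,
    RingTheoryOfRat.not_theoryDecidable_completeTheory_rat⟩
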